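/- For a compact metrizable space $X$, let $C(X)$ be the Banach space of continuous real-valued functions on $X$ with the supremum norm, and let $\mathrm{SRC}(X)$ be the set of all sequences $(f_n)_{n\in\mathbb N}$ of pairwise distinct elements of the closed unit ball of $C(X)$ such that the closure of $\{f_n : n\in\mathbb N\}$ in $\mathbb R^X$ (topology of pointwise convergence) consists of Baire-1 functions, i.e. of pointwise limits of sequences of continuous real-valued functions on $X$. For a sequence $\mathbf g=(g_n)_{n\in\mathbb N}$ in $C(X)$, let $X_{\mathbf g}$ be the (Hausdorff) completion of $c_{00}(\mathbb N)$, the space of finitely supported real sequences, under the seminorm $$\|x\|_{\mathbf g}=\sup\Big\{\Big\|\sum_{n=0}^{k}x(n)g_n\Big\|_\infty : k\in\mathbb N\Big\},$$ and let $(e_n^{\mathbf g})$ be the standard Hamel basis of $c_{00}(\mathbb N)$ regarded as a sequence in $X_{\mathbf g}$. Corollary 5.2. Let $X$ be a compact metrizable space and let $\mathbf g=(g_n)\in\mathrm{SRC}(X)$. Let $K$ be the closed unit ball of the dual $X_{\mathbf g}^*$ with the weak* topology (a compact metrizable space), and regard each $e_n^{\mathbf g}$ as the continuous function $x^*\mapsto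 x^*(e_n^{\mathbf g})$ on $K$. Then $(e_n^{\mathbf g})\in\mathrm{SRC}(K)$. -/

import Mathlib

open TopologicalSpace

set_option linter.unusedSectionVars false

noncomputable section

/-- The real-valued functions of the first Baire class on `X`: the pointwise limits of sequences of
continuous real-valued functions. -/
def BaireOne (X : Type*) [TopologicalSpace X] : Set (X → ℝ) :=
  {h | ∃ u : ℕ → C(X, ℝ), ∀ x, Filter.Tendsto (fun n => u n x) Filter.atTop (nhds (h x))}

/-- For a compact metrizable space `X`, `SRC X` is the set of all sequences `(f_n)` of pairwise
distinct elements of the closed unit ball of `C(X)` whose closure in `ℝ^X` (with the topology of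
pointwise convergence) consists of Baire-1 functions. -/
def SRC (X : Type*) [TopologicalSpace X] [CompactSpace X] [MetrizableSpace X] :
    Set (ℕ → C(X, ℝ)) :=
  {f | (∀ n, ‖f n‖ ≤ 1) ∧
    closure (Set.range fun n => (f n : X → ℝ)) ⊆ BaireOne X ∧
    ∀ n m, n ≠ m → f n ≠ f m}

section Space

variable {X : Type*} [TopologicalSpace X] [CompactSpace X]

/-- The real vector space `c₀₀(ℕ)` of finitely supported sequences, as a type synonym depending on
`g` because it carries the norm `‖·‖_g`. -/
def C00 (_g : ℕ → C(X, ℝ)) : Type := ℕ →₀ ℝ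

namespace C00

variable (g : ℕ → C(X, ℝ))

instance : AddCommGroup (C00 g) := inferInstanceAs (AddCommGroup (ℕ →₀ ℝ))

instance : Module ℝ (C00 g) := inferInstanceAs (Module ℝ (ℕ →₀ ℝ))

/-- The `n`-th coordinate of a finitely supported sequence. -/
def coord (n : ℕ) : C00 g →ₗ[ℝ] ℝ := Finsupp.lapply n

/-- The `n`-th vector of the standard Hamel basis of `c₀₀(ℕ)`. -/
def single (n : ℕ) : C00 g := (Finsupp.single n 1 : ℕ →₀ ℝ)

/-- The partial sum `∑_{n ≤ k} x(n) g_n` in `C(X)`. -/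
def partialSum (k : ℕ) : C00 g →ₗ[ℝ] C(X, ℝ) :=
  ∑ n ∈ Finset.range (k + 1), (coord g n).smulRight (g n)

theorem partialSum_apply (k : ℕ) (x : C00 g) :
    partialSum g k x = ∑ n ∈ Finset.range (k + 1), coord g n x • g n := by
  simp [partialSum, LinearMap.sum_apply]

theorem bddAbove_norm_partialSum (x : C00 g) :
    BddAbove (Set.range fun k => ‖partialSum g k x‖) := by
  refine ⟨∑ n ∈ Finsupp.support (show ℕ →₀ ℝ from x), ‖coord g n x • g n‖, ?_⟩
  rintro _ ⟨k, rfl⟩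
  simp only [partialSum_apply]
  refine (norm_sum_le _ _).trans ?_
  rw [← Finset.sum_filter_ne_zero]
  refine Finset.sum_le_sum_of_subset_of_nonneg (fun n hn => ?_) fun _ _ _ => norm_nonneg _
  refine Finsupp.mem_support_iff.2 fun h => (Finset.mem_filter.1 hn).2 ?_
  have h' : coord g n x = 0 := h
  simp [h']

/-- The seminorm `‖x‖_g = sup_k ‖∑_{n ≤ k} x(n) g_n‖_∞` on `c₀₀(ℕ)`. -/
def gSeminorm : Seminorm ℝ (C00 g) :=
  Seminorm.ofSMulLE (fun x => ⨆ k, ‖partialSum g k x‖)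
    (by simp)
    (fun x y => ciSup_le fun k => by
      rw [map_add]
      exact (norm_add_le _ _).trans (add_le_add
        (le_ciSup (bddAbove_norm_partialSum g x) k) (le_ciSup (bddAbove_norm_partialSum g y) k)))
    (fun r x => ciSup_le fun k => by
      rw [map_smul, norm_smul]
      exact mul_le_mul_of_nonneg_left (le_ciSup (bddAbove_norm_partialSum g x) k) (norm_nonneg r))

instance : SeminormedAddCommGroup (C00 g) :=
  (gSeminorm g).toAddGroupSeminorm.toSeminormedAddCommGroup

theorem norm_eq (x : C00 g) :
    ‖x‖ = ⨆ k : ℕ, ‖∑ n ∈ Finset.range (k + 1), coord g n x • g n‖ := by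
  simp only [← partialSum_apply]
  rfl

instance : NormedSpace ℝ (C00 g) where
  norm_smul_le r x := (map_smul_eq_mul (gSeminorm g) r x).le

theorem span_single : Submodule.span ℝ (Set.range (single g)) = ⊤ :=
  by
  have h := (Finsupp.basisSingleOne (R := ℝ) (ι := ℕ)).span_eq
  rw [Finsupp.coe_basisSingleOne] at h
  exact h

instance : SeparableSpace (C00 g) := by
  rw [← isSeparable_univ_iff]
  have h := (Set.countable_range (single g)).isSeparable.span (R := ℝ)
  rw [span_single] at h
  exact h

end C00

/-- The Banach space `X_g`: the (Hausdorff) completion of `(c₀₀(ℕ), ‖·‖_g)`. -/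
abbrev XSpace (g : ℕ → C(X, ℝ)) : Type := UniformSpace.Completion (C00 g)

/-- The sequence `(e_n^g)`: the standard Hamel basis of `c₀₀(ℕ)` regarded as a sequence in `X_g`. -/
def eBasis (g : ℕ → C(X, ℝ)) (n : ℕ) : XSpace g := (C00.single g n : C00 g)

end Space

section DualBall

variable (E : Type*) [NormedAddCommGroup E] [NormedSpace ℝ E]

/-- The closed unit ball of the dual `E^*` with the weak* topology. -/
abbrev DualBall : Type _ :=
  {φ : WeakDual ℝ E // ‖WeakDual.toStrongDual φ‖ ≤ 1}

theorem isCompact_dualBall : IsCompact {φ : WeakDual ℝ E | ‖WeakDual.toStrongDual φ‖ ≤ 1} := by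
  have h := WeakDual.isCompact_closedBall (𝕜 := ℝ) (E := E) 0 1
  convert h using 1
  ext φ
  simp

instance : CompactSpace (DualBall E) := isCompact_iff_compactSpace.1 (isCompact_dualBall E)

instance [SeparableSpace E] : MetrizableSpace (DualBall E) :=
  WeakDual.metrizable_of_isCompact ℝ E _ (isCompact_dualBall E)

variable {E}

/-- A vector `v : E` regarded as the continuous function `φ ↦ φ(v)` on the closed unit ball of `E^*`
with the weak* topology. -/
def evalDualBall (v : E) : C(DualBall E, ℝ) where
  toFun φ := φ.1 v
  continuous_toFun := (WeakDual.eval_continuous v).comp continuous_subtype_val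

end DualBall

end

/-! A point `F` of the closure is a limit of `e_n` along an ultrafilter `p`; along `p`, `g_n`
converges pointwise to some `h`, which is Baire-1. The content lies in replacing `p` by one
sequence.

For `g` this is Bourgain–Fremlin–Talagrand (`exists_seq_mem_ultrafilter_tendsto`): there are `B k ∈
p` such that every selection from them converges to `h`. Otherwise a Cantor–Bendixson kernel would
yield an independent subsequence, which Baire category on `ℕ → Bool` excludes.

To transfer this to the basis, partial sums with both signs map `c₀₀` into `C(X × ℕ∞ × Bool)` so
that the norm is bounded by a supremum of values. Hahn–Banach and Riesz turn a functional in the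
dual ball into a positive measure, and dominated convergence shows that it cannot asymptotically
separate two selections from the `B k` that tend to infinity. One selection follows `F` at a given
functional; a fixed one therefore converges to `F` everywhere. -/

/-! ### Countable uniform covers and independence -/

/-- `S` is covered by countably many sets on each of which the relation `a n` holds uniformly for
`n` in a member of the filter `p`. -/
def UniformlyCovered {X : Type*} (p : Filter ℕ) (a : ℕ → X → Prop) (S : Set X) : Prop :=
  ∃ A : ℕ → Set ℕ, (∀ j, A j ∈ p) ∧ ∀ x ∈ S, ∃ j, ∀ n ∈ A j, a n x

namespace UniformlyCovered

variable {X : Type*} {p : Filter ℕ} {a b : ℕ → X → Prop}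

theorem mono {S T : Set X} (h : UniformlyCovered p a T) (hST : S ⊆ T)
    (hab : ∀ n, ∀ x ∈ S, a n x → b n x) : UniformlyCovered p b S := by
  obtain ⟨A, hA, h⟩ := h
  refine ⟨A, hA, fun x hx => ?_⟩
  obtain ⟨j, hj⟩ := h x (hST hx)
  exact ⟨j, fun n hn => hab n x hx (hj n hn)⟩

theorem of_forall {S : Set X} {A : Set ℕ} (hA : A ∈ p) (h : ∀ n ∈ A, ∀ x ∈ S, a n x) :
    UniformlyCovered p a S :=
  ⟨fun _ => A, fun _ => hA, fun x hx => ⟨0, fun n hn => h n hn x hx⟩⟩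

theorem iUnion {ι : Type*} [Countable ι] {S : ι → Set X} (h : ∀ i, UniformlyCovered p a (S i)) :
    UniformlyCovered p a (⋃ i, S i) := by
  choose A hA h using h
  obtain hι | hι := isEmpty_or_nonempty ι
  · exact ⟨fun _ => Set.univ, fun _ => Filter.univ_mem, by simp⟩
  obtain ⟨e, he⟩ := exists_surjective_nat (ι × ℕ)
  refine ⟨fun k => A (e k).1 (e k).2, fun k => hA _ _, fun x hx => ?_⟩
  obtain ⟨i, hi⟩ := Set.mem_iUnion.1 hx
  obtain ⟨j, hj⟩ := h i x hi
  obtain ⟨k, hk⟩ := he (i, j)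
  exact ⟨k, by simpa [hk] using hj⟩

/-- A closed set which is not uniformly covered has a nonempty closed kernel such that no nonempty
relatively open subset of it is uniformly covered. -/
theorem exists_kernel [TopologicalSpace X] [SecondCountableTopology X] {Z : Set X}
    (hZ : IsClosed Z) (h : ¬ UniformlyCovered p a Z) :
    ∃ P : Set X, P ⊆ Z ∧ IsClosed P ∧ P.Nonempty ∧
      ∀ W, IsOpen W → (W ∩ P).Nonempty → ¬ UniformlyCovered p a (W ∩ P) := by
  classical
  -- One Cantor–Bendixson step suffices: the part of `Z` removed with these countably many basic
  -- sets is itself covered, so a covered relatively open piece of the remainder would already have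
  -- been removed.
  let 𝒱 : Set (Set X) := {V ∈ countableBasis X | UniformlyCovered p a (V ∩ Z)}
  have hc : Countable 𝒱 := ((countable_countableBasis X).mono fun V hV => hV.1).to_subtype
  have hcov : UniformlyCovered p a (⋃ V : 𝒱, (V : Set X) ∩ Z) := iUnion fun V => V.2.2
  have key : ∀ W, IsOpen W → UniformlyCovered p a (W ∩ (Z \ ⋃ V : 𝒱, (V : Set X))) →
      UniformlyCovered p a (W ∩ Z) := by
    intro W _ hW
    have h2 : UniformlyCovered p a
        (⋃ b : Bool, cond b (W ∩ (Z \ ⋃ V : 𝒱, (V : Set X))) (⋃ V : 𝒱, (V : Set X) ∩ Z)) :=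
      iUnion fun b => by cases b <;> assumption
    refine h2.mono (fun x hx => ?_) fun _ _ _ h => h
    by_cases hxV : x ∈ ⋃ V : 𝒱, (V : Set X)
    · refine Set.mem_iUnion.2 ⟨false, ?_⟩
      obtain ⟨V, hV⟩ := Set.mem_iUnion.1 hxV
      exact Set.mem_iUnion.2 ⟨V, hV, hx.2⟩
    · exact Set.mem_iUnion.2 ⟨true, hx.1, hx.2, hxV⟩
  refine ⟨Z \ ⋃ V : 𝒱, (V : Set X), Set.sdiff_subset, ?_, ?_, ?_⟩
  · exact hZ.sdiff (isOpen_iUnion fun V => isOpen_of_mem_countableBasis V.2.1)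
  · rw [Set.nonempty_iff_ne_empty]
    intro he
    refine h ?_
    have := key Set.univ isOpen_univ
      (by rw [he, Set.inter_empty]; exact of_forall Filter.univ_mem (by simp))
    simpa using this
  · rintro W hW ⟨x, hxW, hxZ, hxV⟩ hc
    obtain ⟨V, hV, hxV', hVW⟩ := (isBasis_countableBasis X).exists_subset_of_mem_open hxW hW
    refine hxV (Set.mem_iUnion.2 ⟨⟨V, hV, ?_⟩, hxV'⟩)
    exact (key W hW hc).mono (Set.inter_subset_inter_left _ hVW) fun _ _ _ h => h

end UniformlyCovered

/-- Two sequences `U`, `V` of open sets such that, along an ultrafilter, `V n` eventually contains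
every point of `P`, while `U n` meets every nonempty relatively open subset of `P`, have
subsequences which are independent on `P`. -/
theorem exists_independent_subsequence {X : Type*} [TopologicalSpace X] (p : Ultrafilter ℕ)
    {P : Set X} (hP : P.Nonempty) {U V : ℕ → Set X} (hU : ∀ n, IsOpen (U n))
    (hV : ∀ n, IsOpen (V n)) (hUV : ∀ n, Disjoint (U n) (V n))
    (hVp : ∀ x ∈ P, ∀ᶠ n in p, x ∈ V n)
    (hUp : ∀ W, IsOpen W → (W ∩ P).Nonempty → ∀ᶠ n in p, (W ∩ P ∩ U n).Nonempty) :
    ∃ n : ℕ → ℕ, ∀ (S : Set ℕ) (T : Finset ℕ),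
      ∃ x ∈ P, ∀ k ∈ T, (k ∈ S → x ∈ U (n k)) ∧ (k ∉ S → x ∈ V (n k)) := by
  classical
  let Indep : Finset ℕ → Prop := fun T => ∀ S ⊆ T, ∃ x ∈ P, ∀ n ∈ T,
    (n ∈ S → x ∈ U n) ∧ (n ∉ S → x ∈ V n)
  have step : ∀ T, Indep T → ∃ n, n ∉ T ∧ Indep (insert n T) := by
    intro T hT
    let W : Finset ℕ → Set X := fun S => ⋂ n ∈ T, if n ∈ S then U n else V n
    have hWo : ∀ S, IsOpen (W S) := fun S => isOpen_biInter_finset fun n _ => by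
      split_ifs
      exacts [hU n, hV n]
    have hW : ∀ S x, x ∈ W S ↔ ∀ n ∈ T, (n ∈ S → x ∈ U n) ∧ (n ∉ S → x ∈ V n) := by
      intro S x
      simp only [W, Set.mem_iInter]
      refine forall₂_congr fun n _ => ?_
      by_cases h : n ∈ S <;> simp [h]
    have hne : ∀ S ⊆ T, (W S ∩ P).Nonempty := fun S hS => by
      obtain ⟨x, hx, h⟩ := hT S hS
      exact ⟨x, (hW S x).2 h, hx⟩
    -- There are only finitely many open cells `W S`, so one `n` splits all of them at once.
    have h1 : ∀ᶠ n in (p : Filter ℕ), ∀ S ∈ T.powerset,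
        (W S ∩ P ∩ U n).Nonempty ∧ (W S ∩ P ∩ V n).Nonempty := by
      refine (Filter.eventually_all_finset _).2 fun S hS => ?_
      have hS := hne S (Finset.mem_powerset.1 hS)
      obtain ⟨x, hx⟩ := id hS
      filter_upwards [hUp _ (hWo S) hS, hVp x hx.2] with n h1 h2
      exact ⟨h1, x, hx, h2⟩
    obtain ⟨n, hn⟩ := h1.exists
    have hnT : n ∉ T := by
      intro hnT
      obtain ⟨⟨x, hx, hxU⟩, -⟩ := hn ∅ (by simp)
      exact Set.disjoint_left.1 (hUV n) hxU (((hW _ x).1 hx.1 n hnT).2 (by simp))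
    refine ⟨n, hnT, fun S _ => ?_⟩
    have hST := hn (S ∩ T) (by simp)
    have aux : ∀ x, x ∈ W (S ∩ T) → ∀ m ∈ T, (m ∈ S → x ∈ U m) ∧ (m ∉ S → x ∈ V m) := by
      intro x hx m hm
      have := (hW _ x).1 hx m hm
      simpa [hm] using this
    by_cases hnS : n ∈ S
    · obtain ⟨x, hx, hxU⟩ := hST.1
      refine ⟨x, hx.2, fun m hm => ?_⟩
      obtain rfl | hm := Finset.mem_insert.1 hm
      · exact ⟨fun _ => hxU, fun h => absurd hnS h⟩
      · exact aux x hx.1 m hm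
    · obtain ⟨x, hx, hxV⟩ := hST.2
      refine ⟨x, hx.2, fun m hm => ?_⟩
      obtain rfl | hm := Finset.mem_insert.1 hm
      · exact ⟨fun h => absurd h hnS, fun _ => hxV⟩
      · exact aux x hx.1 m hm
  have h0 : Indep ∅ := fun S _ => by
    obtain ⟨x, hx⟩ := hP
    exact ⟨x, hx, by simp⟩
  choose! next hnext hI using step
  let T : ℕ → Finset ℕ := fun k => Nat.rec ∅ (fun _ T => insert (next T) T) k
  have hT : ∀ k, Indep (T k) := fun k => by
    induction k with
    | zero => exact h0
    | succ k ih => exact hI _ ih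
  have hTm : Monotone T := monotone_nat_of_le_succ fun k => Finset.subset_insert _ _
  have hmem : ∀ {j k}, j < k → next (T j) ∈ T k := fun {j k} h =>
    hTm (Nat.succ_le_of_lt h) (Finset.mem_insert_self _ _)
  have hinj : Function.Injective fun k => next (T k) := by
    have hne : ∀ {j k}, j < k → next (T j) ≠ next (T k) := fun {j k} hjk he =>
      hnext _ (hT k) (he ▸ hmem hjk)
    intro j k he
    by_contra hjk
    obtain h | h := lt_or_gt_of_ne hjk
    exacts [hne h he, hne h he.symm]
  refine ⟨fun k => next (T k), fun S F => ?_⟩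
  -- By this stage every index in `F` has been selected.
  obtain ⟨x, hx, h⟩ := hT (F.sup id + 1)
    ((T (F.sup id + 1)).filter (· ∈ (fun k => next (T k)) '' S)) (Finset.filter_subset _ _)
  refine ⟨x, hx, fun k hk => ?_⟩
  have hkT : next (T k) ∈ T (F.sup id + 1) := hmem (Nat.lt_succ_of_le (Finset.le_sup (f := id) hk))
  have := h _ hkT
  have hiff : next (T k) ∈ (T (F.sup id + 1)).filter (· ∈ (fun k => next (T k)) '' S) ↔ k ∈ S := by
    rw [Finset.mem_filter]
    exact ⟨fun h => (hinj.mem_set_image).1 h.2, fun h => ⟨hkT, Set.mem_image_of_mem _ h⟩⟩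
  rwa [hiff] at this

/-! ### Limits along ultrafilters and the Bourgain–Fremlin–Talagrand theorem -/

theorem exists_tendsto_ultrafilter {X : Type*} [TopologicalSpace X] [CompactSpace X]
    {f : ℕ → C(X, ℝ)} (hf : ∀ n, ‖f n‖ ≤ 1) (p : Ultrafilter ℕ) :
    ∃ h ∈ closure (Set.range fun n => (f n : X → ℝ)),
      ∀ x, Filter.Tendsto (fun n => f n x) p (nhds (h x)) := by
  have h1 : ∀ x, ∃ y, Filter.Tendsto (fun n => f n x) p (nhds y) := fun x => by
    obtain ⟨y, -, hy⟩ := (isCompact_Icc (a := (-1 : ℝ)) (b := 1)).ultrafilter_le_nhds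
      (p.map fun n : ℕ => f n x) (by
        rw [Filter.le_principal_iff]
        refine Filter.mem_map.2 (Filter.Eventually.of_forall fun n => ?_)
        exact abs_le.1 (((f n).norm_coe_le_norm x).trans (hf n)))
    exact ⟨y, hy⟩
  choose h hh using h1
  refine ⟨h, ?_, hh⟩
  exact mem_closure_of_tendsto (tendsto_pi_nhds.2 hh)
    (Filter.Eventually.of_forall fun n => Set.mem_range_self n)

/-- A bounded sequence of continuous functions whose pointwise closure consists of Baire-1 functions
has no independent subsequence, even after a translation by a continuous function. -/
theorem not_independent_of_closure_subset_baireOne {X : Type*} [TopologicalSpace X]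
    [CompactSpace X] {f : ℕ → C(X, ℝ)} (hf : ∀ n, ‖f n‖ ≤ 1)
    (hB : closure (Set.range fun n => (f n : X → ℝ)) ⊆ BaireOne X) (u : C(X, ℝ)) {δ ε : ℝ}
    (hδε : δ < ε) : ¬ ∀ S : Set ℕ, ∃ x, ∀ k,
      (k ∈ S → ε ≤ |f k x - u x|) ∧ (k ∉ S → |f k x - u x| ≤ δ) := by
  intro hind
  let q : Ultrafilter ℕ := Filter.hyperfilter ℕ
  obtain ⟨h, hmem, hlim⟩ := exists_tendsto_ultrafilter hf q
  obtain ⟨v, hv⟩ := hB hmem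
  have hlim' : ∀ x, Filter.Tendsto (fun n => |f n x - u x|) q (nhds |h x - u x|) :=
    fun x => ((hlim x).sub_const _).abs
  have hv' : ∀ x, Filter.Tendsto (fun n => |v n x - u x|) Filter.atTop (nhds |h x - u x|) :=
    fun x => ((hv x).sub_const _).abs
  let c := (δ + ε) / 2
  have hδc : δ < c := by simp only [c]; linarith
  have hcε : c < ε := by simp only [c]; linarith
  let pat : Set (X × (ℕ → Bool)) := {z | ∀ k, (z.2 k = true ∧ ε ≤ |f k z.1 - u z.1|) ∨
    (z.2 k = false ∧ |f k z.1 - u z.1| ≤ δ)}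
  have hcont : ∀ w : C(X, ℝ), Continuous fun z : X × (ℕ → Bool) => |w z.1 - u z.1| :=
    fun w => by fun_prop
  have hpat : IsClosed pat := by
    simp only [pat, Set.ofPred_forall]
    refine isClosed_iInter fun k => ?_
    refine IsClosed.union (IsClosed.inter ?_ ?_) (IsClosed.inter ?_ ?_)
    · exact isClosed_eq (by fun_prop) continuous_const
    · exact isClosed_le continuous_const (hcont _)
    · exact isClosed_eq (by fun_prop) continuous_const
    · exact isClosed_le (hcont _) continuous_const
  let big : ℕ → Set (X × (ℕ → Bool)) := fun m => {z | ∀ i, m ≤ i → c ≤ |v i z.1 - u z.1|}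
  let small : ℕ → Set (X × (ℕ → Bool)) := fun m => {z | ∀ i, m ≤ i → |v i z.1 - u z.1| ≤ c}
  have hbig : ∀ m, IsClosed (big m) := fun m => by
    simp only [big, Set.ofPred_forall]
    exact isClosed_iInter fun i => isClosed_iInter fun _ =>
      isClosed_le continuous_const (hcont _)
  have hsmall : ∀ m, IsClosed (small m) := fun m => by
    simp only [small, Set.ofPred_forall]
    exact isClosed_iInter fun i => isClosed_iInter fun _ =>
      isClosed_le (hcont _) continuous_const
  have hpat_mem : ∀ z ∈ pat, {k | z.2 k = true} ∈ q → ε ≤ |h z.1 - u z.1| := by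
    intro z hz hq
    refine ge_of_tendsto (hlim' z.1) ?_
    filter_upwards [hq] with k hk
    obtain h | h := hz k
    · exact h.2
    · simp [h.1] at hk
  have hpat_not_mem : ∀ z ∈ pat, {k | z.2 k = true} ∉ q → |h z.1 - u z.1| ≤ δ := by
    intro z hz hq
    refine le_of_tendsto (hlim' z.1) ?_
    filter_upwards [Ultrafilter.compl_mem_iff_notMem.2 hq] with k hk
    obtain h | h := hz k
    · exact absurd h.1 hk
    · exact h.2
  -- Membership of a pattern in `q` is decided by whether `|h - u|` is above or below `c`; since `h`
  -- is a limit of the `v i`, this splits Cantor space into countably many closed sets.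
  let C : Bool × ℕ → Set (ℕ → Bool) := fun i =>
    Prod.snd '' (pat ∩ cond i.1 (big i.2) (small i.2))
  have hC : ∀ i, IsClosed (C i) := by
    rintro ⟨b, m⟩
    refine isClosedMap_snd_of_compactSpace _ (hpat.inter ?_)
    cases b
    exacts [hsmall m, hbig m]
  have hCU : ⋃ i, C i = Set.univ := by
    refine Set.eq_univ_of_forall fun s => ?_
    obtain ⟨x, hx⟩ := hind {k | s k = true}
    have hz : (x, s) ∈ pat := fun k => by
      cases hk : s k
      · exact Or.inr ⟨hk, (hx k).2 (by simp [hk])⟩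
      · exact Or.inl ⟨hk, (hx k).1 hk⟩
    by_cases hs : {k | s k = true} ∈ q
    · obtain ⟨m, hm⟩ := Filter.eventually_atTop.1
        ((hv' x).eventually (lt_mem_nhds (hcε.trans_le (hpat_mem _ hz hs))))
      exact Set.mem_iUnion.2 ⟨(true, m), (x, s), ⟨hz, fun i hi => (hm i hi).le⟩, rfl⟩
    · obtain ⟨m, hm⟩ := Filter.eventually_atTop.1
        ((hv' x).eventually (gt_mem_nhds ((hpat_not_mem _ hz hs).trans_lt hδc)))
      exact Set.mem_iUnion.2 ⟨(false, m), (x, s), ⟨hz, fun i hi => (hm i hi).le⟩, rfl⟩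
  have hCt : ∀ m, ∀ s ∈ C (true, m), {k | s k = true} ∈ q := by
    rintro m _ ⟨z, ⟨hz, hb⟩, rfl⟩
    by_contra hq
    have h1 := hpat_not_mem z hz hq
    have h2 : c ≤ |h z.1 - u z.1| := ge_of_tendsto (hv' z.1) (Filter.eventually_atTop.2 ⟨m, hb⟩)
    linarith
  have hCf : ∀ m, ∀ s ∈ C (false, m), {k | s k = true} ∉ q := by
    rintro m _ ⟨z, ⟨hz, hb⟩, rfl⟩ hq
    have h1 := hpat_mem z hz hq
    have h2 : |h z.1 - u z.1| ≤ c := le_of_tendsto (hv' z.1) (Filter.eventually_atTop.2 ⟨m, hb⟩)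
    linarith
  -- By Baire some piece contains a cylinder. Its patterns are free off the finite set `I`, so they
  -- can be made to lie in `q` or not, at will.
  obtain ⟨⟨b, m⟩, s, hs⟩ := nonempty_interior_of_iUnion_of_closed hC hCU
  obtain ⟨I, W, hW, hIW⟩ := isOpen_pi_iff.1 isOpen_interior s hs
  classical
  have hmod : ∀ b' : Bool, (fun k => if k ∈ I then s k else b') ∈ C (b, m) := fun b' => by
    refine interior_subset (hIW fun k hk => ?_)
    have hk' : k ∈ I := hk
    simpa [hk'] using (hW k hk').2
  have hcof : ((I : Set ℕ)ᶜ) ∈ q := Set.Finite.compl_mem_hyperfilter I.finite_toSet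
  cases b
  · refine hCf m _ (hmod true) ?_
    filter_upwards [hcof] with k hk
    have hk' : k ∉ I := hk
    simp [hk']
  · have h1 := hCt m _ (hmod false)
    obtain ⟨k, hk, hk'⟩ := (Filter.inter_mem h1 hcof |> q.nonempty_of_mem)
    have hk'' : k ∉ I := hk'
    simp [hk''] at hk

/-- The Bourgain–Fremlin–Talagrand theorem in the bisequential form: for a bounded sequence of
continuous functions on a compact metrizable space whose pointwise closure consists of Baire-1
functions, an ultrafilter converging pointwise contains a sequence of sets converging pointwise. -/
theorem exists_seq_mem_ultrafilter_tendsto {X : Type*} [TopologicalSpace X] [CompactSpace X]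
    [MetrizableSpace X] {f : ℕ → C(X, ℝ)} (hf : ∀ n, ‖f n‖ ≤ 1)
    (hB : closure (Set.range fun n => (f n : X → ℝ)) ⊆ BaireOne X) (p : Ultrafilter ℕ) {h : X → ℝ}
    (hh : h ∈ BaireOne X) (hlim : ∀ x, Filter.Tendsto (fun n => f n x) p (nhds (h x))) :
    ∃ B : ℕ → Set ℕ, (∀ k, B k ∈ p) ∧ ∀ n : ℕ → ℕ, (∀ k, n k ∈ B k) →
      ∀ x, Filter.Tendsto (fun k => f (n k) x) Filter.atTop (nhds (h x)) := by
  let := metrizableSpaceMetric X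
  have key : ∀ ε : ℝ, 0 < ε → UniformlyCovered p (fun n x => |f n x - h x| ≤ ε) Set.univ := by
    intro ε hε
    obtain ⟨u, hu⟩ := hh
    -- On `Z N` the limit `h` is within `ε / 8` of the continuous `u N`: below the threshold `ε / 4`
    -- of `V`, and small enough that `ε / 2 + ε / 8 ≤ ε`.
    let Z : ℕ → Set X := fun N => {x | ∀ m, N ≤ m → |u m x - u N x| ≤ ε / 8}
    have hZ : ∀ N, IsClosed (Z N) := fun N => by
      simp only [Z, Set.ofPred_forall]
      exact isClosed_iInter fun i => isClosed_iInter fun _ =>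
        isClosed_le (by fun_prop) continuous_const
    have hZU : (Set.univ : Set X) ⊆ ⋃ N, Z N := fun x _ => by
      obtain ⟨N, hN⟩ := Metric.cauchySeq_iff'.1 (hu x).cauchySeq (ε / 8) (by positivity)
      exact Set.mem_iUnion.2 ⟨N, fun m hm => (hN m hm).le⟩
    have hZh : ∀ N, ∀ x ∈ Z N, |h x - u N x| ≤ ε / 8 := fun N x hx =>
      le_of_tendsto ((hu x).sub_const _).abs (Filter.eventually_atTop.2 ⟨N, hx⟩)
    refine UniformlyCovered.mono (UniformlyCovered.iUnion fun N => ?_) hZU fun _ _ _ h => h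
    suffices hs : UniformlyCovered p (fun n x => |f n x - u N x| ≤ ε / 2) (Z N) by
      refine hs.mono subset_rfl fun n x hx hn => ?_
      have h1 := hZh N x hx
      have h2 := abs_sub_le (f n x) (u N x) (h x)
      rw [abs_sub_comm (u N x)] at h2
      linarith
    by_contra hnot
    obtain ⟨P, hPZ, hPc, hPne, hP⟩ := UniformlyCovered.exists_kernel (hZ N) hnot
    obtain ⟨n, hn⟩ := exists_independent_subsequence p hPne
      (U := fun n => {x | ε / 2 < |f n x - u N x|}) (V := fun n => {x | |f n x - u N x| < ε / 4})
      (fun n => isOpen_lt continuous_const (by fun_prop))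
      (fun n => isOpen_lt (by fun_prop) continuous_const)
      (fun n => Set.disjoint_left.2 fun x h1 h2 => by
        simp only [Set.mem_ofPred_eq] at h1 h2
        linarith)
      (fun x hx => by
        have h1 := hZh N x (hPZ hx)
        exact ((hlim x).sub_const (u N x)).abs.eventually
          (gt_mem_nhds (h1.trans_lt (by linarith))))
      (fun W hW hWP => by
        by_contra hc
        refine hP W hW hWP ?_
        refine UniformlyCovered.of_forall (Ultrafilter.eventually_not.2 hc) fun n hn x hx => ?_
        by_contra hx'
        exact hn ⟨x, hx, not_le.1 hx'⟩)
    refine not_independent_of_closure_subset_baireOne (f := fun k => f (n k)) (fun k => hf _)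
      ((closure_mono ?_).trans hB) (u N) (show ε / 4 < ε / 2 by linarith) fun S => ?_
    · rintro _ ⟨k, rfl⟩
      exact ⟨n k, rfl⟩
    -- Weakening the strict inequalities makes the conditions closed, so compactness of `P` passes
    -- from finite to infinite patterns.
    · let Q : ℕ → Set X := fun k => {x | (k ∈ S → ε / 2 ≤ |f (n k) x - u N x|) ∧
        (k ∉ S → |f (n k) x - u N x| ≤ ε / 4)}
      have hQ : ∀ k, IsClosed (Q k) := fun k => by
        by_cases hk : k ∈ S
        · simpa [Q, hk] using isClosed_le (f := fun _ : X => ε / 2)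
            (g := fun x => |f (n k) x - u N x|) continuous_const (by fun_prop)
        · simpa [Q, hk] using isClosed_le (g := fun _ : X => ε / 4)
            (f := fun x => |f (n k) x - u N x|) (by fun_prop) continuous_const
      obtain ⟨x, -, hx⟩ := hPc.isCompact.inter_iInter_nonempty Q hQ fun T => by
        obtain ⟨x, hx, hT⟩ := hn S T
        refine ⟨x, hx, Set.mem_iInter₂.2 fun k hk => ?_⟩
        exact ⟨fun h => ((hT k hk).1 h).le, fun h => ((hT k hk).2 h).le⟩
      exact ⟨x, fun k => Set.mem_iInter.1 hx k⟩
  choose A hA hcov using fun m : ℕ => key (1 / ((m : ℝ) + 1)) (by positivity)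
  obtain ⟨e, he⟩ := exists_surjective_nat (ℕ × ℕ)
  refine ⟨fun k => ⋂ i ∈ Finset.range (k + 1), A (e i).1 (e i).2,
    fun k => (Filter.biInter_finset_mem _).2 fun i _ => hA _ _, fun n hn x => ?_⟩
  rw [Metric.tendsto_atTop]
  intro ε hε
  obtain ⟨m, hm⟩ := exists_nat_one_div_lt hε
  obtain ⟨j, hj⟩ := hcov m x (Set.mem_univ x)
  obtain ⟨i, hi⟩ := he (m, j)
  refine ⟨i, fun k hk => (hj (n k) ?_).trans_lt hm⟩
  have := Set.mem_iInter₂.1 (hn k) i (Finset.mem_range.2 (Nat.lt_succ_of_le hk))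
  rwa [hi] at this

/-! ### Positive functionals and dominated convergence -/

/-- A linear functional dominated by the supremum of the image under a linear map into `C(Y)` is
represented by a positive functional on `C(Y)`. -/
theorem exists_positive_functional {E Y : Type*} [AddCommGroup E] [Module ℝ E] [TopologicalSpace Y]
    [CompactSpace Y] (T : E →ₗ[ℝ] C(Y, ℝ)) (φ : E →ₗ[ℝ] ℝ) (hφ : ∀ v, φ v ≤ ⨆ y, T v y) :
    ∃ Λ : C(Y, ℝ) →ₗ[ℝ] ℝ, (∀ f, 0 ≤ f → 0 ≤ Λ f) ∧ ∀ v, Λ (T v) = φ v := by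
  have hker : LinearMap.ker T ≤ LinearMap.ker φ := fun v hv => by
    have hv : T v = 0 := hv
    have h1 := hφ v
    have h2 := hφ (-v)
    simp only [map_neg, hv, neg_zero, ContinuousMap.zero_apply, Real.iSup_const_zero] at h1 h2
    exact le_antisymm h1 (by linarith)
  let ψ : LinearMap.range T →ₗ[ℝ] ℝ :=
    ((LinearMap.ker T).liftQ φ hker).comp T.quotKerEquivRange.symm.toLinearMap
  have hψ : ∀ v, ψ ⟨T v, v, rfl⟩ = φ v := fun v => by
    have h : T.quotKerEquivRange.symm ⟨T v, v, rfl⟩ = (LinearMap.ker T).mkQ v := by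
      rw [LinearEquiv.symm_apply_eq]
      rfl
    simp only [ψ, LinearMap.comp_apply, LinearEquiv.coe_coe, h]
    simp
  have hbdd : ∀ f : C(Y, ℝ), BddAbove (Set.range f) := fun f =>
    (isCompact_range f.continuous).bddAbove
  -- Dominating by the supremum rather than the norm is what forces positivity: for `f ≥ 0`, `Λ (-f)
  -- ≤ sup (-f) ≤ 0`.
  obtain ⟨Λ, hΛ, hle⟩ := exists_extension_of_le_sublinear ⟨LinearMap.range T, ψ⟩
    (fun f => ⨆ y, f y)
    (fun c hc f => by
      simp only [ContinuousMap.smul_apply, smul_eq_mul]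
      exact (Real.mul_iSup_of_nonneg hc.le _).symm)
    (fun f g => by
      obtain hY | hY := isEmpty_or_nonempty Y
      · simp
      · exact ciSup_le fun y => add_le_add (le_ciSup (hbdd f) y) (le_ciSup (hbdd g) y))
    (by
      rintro ⟨_, v, rfl⟩
      exact (hψ v).trans_le (hφ v))
  refine ⟨Λ, fun f hf => ?_, fun v => (hΛ ⟨T v, v, rfl⟩).trans (hψ v)⟩
  have h1 := hle (-f)
  have h2 : ⨆ y, (-f) y ≤ 0 := Real.iSup_nonpos fun y => neg_nonpos.2 (hf y)
  rw [map_neg] at h1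
  linarith

/-- A positive functional on `C(Y)` maps bounded pointwise null sequences to null sequences. -/
theorem tendsto_positive_functional {Y : Type*} [TopologicalSpace Y] [CompactSpace Y] [T2Space Y]
    (Λ : C(Y, ℝ) →ₗ[ℝ] ℝ) (hΛ : ∀ f, 0 ≤ f → 0 ≤ Λ f) {f : ℕ → C(Y, ℝ)} {c : ℝ}
    (hc : ∀ n y, |f n y| ≤ c) (hf : ∀ y, Filter.Tendsto (fun n => f n y) Filter.atTop (nhds 0)) :
    Filter.Tendsto (fun n => Λ (f n)) Filter.atTop (nhds 0) := by
  borelize Y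
  let Λ' : CompactlySupportedContinuousMap Y ℝ →ₗ[ℝ] ℝ :=
    { toFun := fun f => Λ f.toContinuousMap
      map_add' := fun f g => Λ.map_add _ _
      map_smul' := fun r f => Λ.map_smul _ _ }
  let Λp : CompactlySupportedContinuousMap Y ℝ →ₚ[ℝ] ℝ :=
    PositiveLinearMap.mk₀ Λ' fun f hf => hΛ _ hf
  have hint : ∀ f : C(Y, ℝ), ∫ y, f y ∂(RealRMK.rieszMeasure Λp) = Λ f := fun f =>
    RealRMK.integral_rieszMeasure Λp (CompactlySupportedContinuousMap.continuousMapEquiv f)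
  simp only [← hint]
  rw [← MeasureTheory.integral_zero Y ℝ (μ := RealRMK.rieszMeasure Λp)]
  refine MeasureTheory.tendsto_integral_of_dominated_convergence (fun _ => c) (fun n => ?_) ?_
    (fun n => Filter.Eventually.of_forall fun y => hc n y) (Filter.Eventually.of_forall hf)
  · exact (f n).continuous.aestronglyMeasurable
  · exact MeasureTheory.integrable_const c

/-! ### Functionals on `X_g` as measures on `X × ℕ∞ × Bool` -/

section XSpace

variable {X : Type*} [TopologicalSpace X] [CompactSpace X] (g : ℕ → C(X, ℝ))

/-- This makes the cut-off `1_{n ≤ k}` continuous in `k`, including at infinity. -/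
theorem isClopen_Ici_natCast (n : ℕ) : IsClopen (Set.Ici (n : ℕ∞)) := by
  refine ⟨isClosed_Ici, ?_⟩
  cases n with
  | zero => simp
  | succ n =>
    have : Set.Ici ((n + 1 : ℕ) : ℕ∞) = Set.Ioi (n : ℕ∞) := by
      ext k
      simp [ENat.add_one_le_iff]
    rw [this]
    exact isOpen_Ioi

/-- The function `(x, k, b) ↦ ± g_n(x) 1_{n ≤ k}` on `X × ℕ∞ × Bool`, with sign given by `b`. -/
noncomputable def signedTruncation (n : ℕ) : C(X × ℕ∞ × Bool, ℝ) where
  toFun z := (cond z.2.2 1 (-1)) * (g n z.1 * (Set.Ici (n : ℕ∞)).indicator 1 z.2.1)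
  continuous_toFun := by
    have h1 : Continuous ((Set.Ici (n : ℕ∞)).indicator (1 : ℕ∞ → ℝ)) :=
      continuous_one.indicator fun a ha => by simp [(isClopen_Ici_natCast n).frontier_eq] at ha
    have h2 : Continuous fun b : Bool => cond b (1 : ℝ) (-1) := continuous_of_discreteTopology
    exact (h2.comp (by fun_prop)).mul (((g n).continuous.comp (by fun_prop)).mul
      (h1.comp (by fun_prop)))

namespace C00

/-- The linear map from `c₀₀(ℕ)` to the continuous functions on `X × ℕ∞ × Bool` whose value at
`(x, k, ±)` is, up to sign, the `k`-th partial sum at `x`. -/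
noncomputable def toSignedTruncation : C00 g →ₗ[ℝ] C(X × ℕ∞ × Bool, ℝ) :=
  Finsupp.linearCombination ℝ (signedTruncation g)

theorem toSignedTruncation_single (n : ℕ) :
    toSignedTruncation g (single g n) = signedTruncation g n :=
  (Finsupp.linearCombination_single ℝ (1 : ℝ) n).trans (one_smul _ _)

theorem coord_single (m n : ℕ) : coord g m (single g n) = if m = n then 1 else 0 :=
  (Finsupp.single_apply (a := n) (b := (1 : ℝ)) (a' := m)).trans (by simp [eq_comm])

theorem partialSum_single (k n : ℕ) :
    partialSum g k (single g n) = if n ≤ k then g n else 0 := by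
  simp [partialSum_apply, coord_single]

theorem toSignedTruncation_apply (v : C00 g) (x : X) (k : ℕ) (b : Bool) :
    toSignedTruncation g v (x, (k : ℕ∞), b) = (cond b 1 (-1)) * partialSum g k v x := by
  have h : (ContinuousMap.evalCLM ℝ (x, (k : ℕ∞), b)).toLinearMap.comp (toSignedTruncation g) =
      (cond b (1 : ℝ) (-1)) •
        (ContinuousMap.evalCLM ℝ x).toLinearMap.comp (partialSum g k) := by
    refine LinearMap.ext_on_range (span_single g) fun n => ?_
    simp only [LinearMap.comp_apply, LinearMap.smul_apply, toSignedTruncation_single,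
      partialSum_single]
    by_cases hn : n ≤ k <;> simp [signedTruncation, hn]
  exact LinearMap.congr_fun h v

theorem norm_partialSum_le (k : ℕ) (v : C00 g) : ‖partialSum g k v‖ ≤ ‖v‖ :=
  le_ciSup (bddAbove_norm_partialSum g v) k

theorem norm_le_of_partialSum {v : C00 g} {c : ℝ} (h : ∀ k, ‖partialSum g k v‖ ≤ c) : ‖v‖ ≤ c :=
  ciSup_le h

/-- The two signs turn a supremum of absolute values into a plain supremum, as
`exists_positive_functional` requires. -/
theorem norm_le_iSup_toSignedTruncation [Nonempty X] (v : C00 g) :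
    ‖v‖ ≤ ⨆ y, toSignedTruncation g v y := by
  have hb : BddAbove (Set.range (toSignedTruncation g v)) :=
    (isCompact_range (toSignedTruncation g v).continuous).bddAbove
  have h : ∀ k x, |partialSum g k v x| ≤ ⨆ y, toSignedTruncation g v y := fun k x => by
    have h1 := le_ciSup hb (x, (k : ℕ∞), true)
    have h2 := le_ciSup hb (x, (k : ℕ∞), false)
    rw [toSignedTruncation_apply] at h1 h2
    simp only [cond_true, cond_false] at h1 h2
    exact abs_le.2 ⟨by linarith, by linarith⟩
  exact norm_le_of_partialSum g fun k => (ContinuousMap.norm_le_of_nonempty _).2 (h k)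

end C00

/-- If two subsequences of `g` tend to infinity and have pointwise null difference, then so do the
corresponding subsequences of the basis, weakly. -/
theorem tendsto_functional_single_sub [T2Space X] (hg : ∀ n, ‖g n‖ ≤ 1) (φ : C00 g →ₗ[ℝ] ℝ)
    (hφ : ∀ v, |φ v| ≤ ‖v‖) {m n : ℕ → ℕ} (hm : Filter.Tendsto m Filter.atTop Filter.atTop)
    (hn : Filter.Tendsto n Filter.atTop Filter.atTop)
    (hmn : ∀ x, Filter.Tendsto (fun k => g (m k) x - g (n k) x) Filter.atTop (nhds 0)) [Nonempty X] :
    Filter.Tendsto (fun k => φ (C00.single g (m k) - C00.single g (n k))) Filter.atTop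
      (nhds 0) := by
  obtain ⟨Λ, hΛ, h⟩ := exists_positive_functional (C00.toSignedTruncation g) φ fun v =>
    (le_abs_self _).trans ((hφ v).trans (C00.norm_le_iSup_toSignedTruncation g v))
  simp only [← h]
  have hbd : ∀ n y, |signedTruncation g n y| ≤ 1 := by
    rintro n ⟨x, k, b⟩
    have h1 : |g n x| ≤ 1 := ((g n).norm_coe_le_norm x).trans (hg n)
    by_cases hk : (n : ℕ∞) ≤ k <;> cases b <;> simp [signedTruncation, hk, h1]
  refine tendsto_positive_functional Λ hΛ (c := 2) (fun k y => ?_) ?_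
  · rw [map_sub, C00.toSignedTruncation_single, C00.toSignedTruncation_single]
    have := abs_sub (signedTruncation g (m k) y) (signedTruncation g (n k) y)
    exact this.trans (by linarith [hbd (m k) y, hbd (n k) y])
  -- At `k = ∞` this is the hypothesis on `g`; at finite `k` both truncations eventually vanish.
  · rintro ⟨x, k, b⟩
    simp only [map_sub, C00.toSignedTruncation_single, ContinuousMap.sub_apply]
    induction k using ENat.recTopCoe with
    | top =>
      simpa [signedTruncation, mul_sub] using (hmn x).const_mul (cond b (1 : ℝ) (-1))
    | coe k =>
      refine tendsto_const_nhds.congr' ?_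
      filter_upwards [hm.eventually_gt_atTop k, hn.eventually_gt_atTop k] with i h1 h2
      simp [signedTruncation, h1, h2]

end XSpace

/-! ### The basis as functions on the dual ball -/

section XSpace

variable {X : Type*} [TopologicalSpace X] [CompactSpace X] {g : ℕ → C(X, ℝ)}

theorem norm_eBasis_le (hg : ∀ n, ‖g n‖ ≤ 1) (n : ℕ) : ‖eBasis g n‖ ≤ 1 := by
  rw [eBasis, UniformSpace.Completion.norm_coe]
  refine C00.norm_le_of_partialSum g fun k => ?_
  rw [C00.partialSum_single]
  split_ifs
  · exact hg n
  · simp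

theorem eBasis_ne (hg : ∀ n m, n ≠ m → g n ≠ g m) {n m : ℕ} (hnm : n ≠ m) :
    eBasis g n ≠ eBasis g m := by
  intro h
  have h1 : ‖C00.single g n - C00.single g m‖ = 0 := by
    rw [← UniformSpace.Completion.norm_coe, UniformSpace.Completion.coe_sub, norm_eq_zero,
      sub_eq_zero]
    exact h
  have h2 := C00.norm_partialSum_le g (max n m) (C00.single g n - C00.single g m)
  rw [h1, map_sub, C00.partialSum_single, C00.partialSum_single, if_pos (le_max_left _ _),
    if_pos (le_max_right _ _), norm_le_zero_iff, sub_eq_zero] at h2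
  exact hg n m hnm h2

end XSpace

section DualBall

variable {E : Type*} [NormedAddCommGroup E] [NormedSpace ℝ E]

theorem DualBall.abs_apply_le (φ : DualBall E) (v : E) : |φ.1 v| ≤ ‖v‖ :=
  ((WeakDual.toStrongDual φ.1).le_opNorm v).trans
    (mul_le_of_le_one_left (norm_nonneg v) φ.2)

theorem norm_evalDualBall_le (v : E) : ‖evalDualBall v‖ ≤ ‖v‖ :=
  (ContinuousMap.norm_le _ (norm_nonneg v)).2 fun φ => φ.abs_apply_le v

theorem evalDualBall_injective : Function.Injective (evalDualBall : E → C(DualBall E, ℝ)) := by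
  intro v w h
  by_contra hvw
  obtain ⟨φ, hφ, hφv⟩ := exists_dual_vector ℝ (v - w) (norm_ne_zero_iff.2 (sub_ne_zero.2 hvw))
  have h1 : φ v = φ w := DFunLike.congr_fun h (⟨StrongDual.toWeakDual φ, hφ.le⟩ : DualBall E)
  rw [map_sub, h1, sub_self] at hφv
  exact hvw (sub_eq_zero.1 (norm_eq_zero.1 (by exact_mod_cast hφv.symm)))

end DualBall

/-- Every point in the pointwise closure of the basis of `X_g` is a Baire-1 function on the dual
ball. -/
theorem closure_evalDualBall_eBasis_subset {X : Type*} [TopologicalSpace X] [CompactSpace X]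
    [MetrizableSpace X] [Nonempty X] {g : ℕ → C(X, ℝ)} (hg : ∀ n, ‖g n‖ ≤ 1)
    (hB : closure (Set.range fun n => (g n : X → ℝ)) ⊆ BaireOne X) :
    closure (Set.range fun n => (evalDualBall (eBasis g n) : DualBall (XSpace g) → ℝ)) ⊆
      BaireOne (DualBall (XSpace g)) := by
  intro F hF
  obtain ⟨p, hp⟩ : ∃ p : Ultrafilter ℕ, Filter.Tendsto
      (fun n => (evalDualBall (eBasis g n) : DualBall (XSpace g) → ℝ)) p (nhds F) := by
    have : (Filter.comap (fun n => (evalDualBall (eBasis g n) : DualBall (XSpace g) → ℝ))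
        (nhds F)).NeBot := by
      rw [Filter.comap_neBot_iff]
      intro t ht
      obtain ⟨_, h, n, rfl⟩ := mem_closure_iff_nhds.1 hF t ht
      exact ⟨n, h⟩
    exact ⟨Ultrafilter.of _, Filter.tendsto_iff_comap.2 (Ultrafilter.of_le _)⟩
  rw [tendsto_pi_nhds] at hp
  obtain ⟨h, hmem, hlim⟩ := exists_tendsto_ultrafilter hg p
  obtain ⟨B, hBp, hBlim⟩ := exists_seq_mem_ultrafilter_tendsto hg hB p (hB hmem) hlim
  obtain hcof | ⟨n, hn⟩ := p.le_cofinite_or_eq_pure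
  swap
  · refine ⟨fun _ => evalDualBall (eBasis g n), fun φ => ?_⟩
    have h1 := hp φ
    rw [hn, Ultrafilter.coe_pure] at h1
    rw [tendsto_nhds_unique h1 (tendsto_pure_nhds (fun n => evalDualBall (eBasis g n) φ) n)]
    exact tendsto_const_nhds
  have hI : ∀ k, Set.Ioi k ∈ p := fun k => by
    rw [Nat.cofinite_eq_atTop] at hcof
    exact hcof (Filter.Ioi_mem_atTop k)
  have hBI : ∀ k, B k ∩ Set.Ioi k ∈ p := fun k => Filter.inter_mem (hBp k) (hI k)
  -- This selection does not depend on the functional; the selection `m` below does.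
  choose n hn using fun k => p.nonempty_of_mem (hBI k)
  have htop : ∀ m : ℕ → ℕ, (∀ k, k < m k) → Filter.Tendsto m Filter.atTop Filter.atTop :=
    fun m hm => Filter.tendsto_atTop_mono (fun k => (hm k).le) Filter.tendsto_id
  refine ⟨fun k => evalDualBall (eBasis g (n k)), fun φ => ?_⟩
  have hU : ∀ k : ℕ, {i | |evalDualBall (eBasis g i) φ - F φ| < 1 / ((k : ℝ) + 1)} ∈ p := fun k =>
    (hp φ).eventually (Metric.ball_mem_nhds (F φ) (by positivity))
  choose m hm using fun k => p.nonempty_of_mem (Filter.inter_mem (hBI k) (hU k))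
  have hmF : Filter.Tendsto (fun k => evalDualBall (eBasis g (m k)) φ) Filter.atTop
      (nhds (F φ)) := by
    rw [tendsto_iff_dist_tendsto_zero]
    exact squeeze_zero (fun _ => dist_nonneg) (fun k => (hm k).2.le)
      tendsto_one_div_add_atTop_nhds_zero_nat
  let ψ : C00 g →ₗ[ℝ] ℝ :=
    (WeakDual.toStrongDual φ.1).toLinearMap.comp
      (UniformSpace.Completion.toComplL (𝕜 := ℝ) (E := C00 g)).toLinearMap
  have hψ : ∀ v, |ψ v| ≤ ‖v‖ := fun v =>
    (φ.abs_apply_le (v : XSpace g)).trans (UniformSpace.Completion.norm_coe v).le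
  have hsub := tendsto_functional_single_sub g hg ψ hψ (htop n fun k => (hn k).2)
    (htop m fun k => (hm k).1.2) fun x => by
      simpa using (hBlim n (fun k => (hn k).1) x).sub (hBlim m (fun k => (hm k).1.1) x)
  have hadd := hsub.add hmF
  rw [zero_add] at hadd
  refine hadd.congr fun k => ?_
  rw [map_sub]
  exact sub_add_cancel (ψ (C00.single g (n k))) (ψ (C00.single g (m k)))

theorem corollary5p2 {X : Type*} [TopologicalSpace X] [CompactSpace X] [MetrizableSpace X]
    (g : ℕ → C(X, ℝ)) (hg : g ∈ SRC X) :
    (fun n => evalDualBall (eBasis g n)) ∈ SRC (DualBall (XSpace g)) := by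
  obtain ⟨hg1, hgB, hgne⟩ := hg
  -- Over an empty `X` all continuous functions coincide, against distinctness.
  have hX : Nonempty X := by
    by_contra hX
    rw [not_nonempty_iff] at hX
    exact hgne 0 1 zero_ne_one (Subsingleton.elim _ _)
  exact ⟨fun n => (norm_evalDualBall_le _).trans (norm_eBasis_le hg1 n),
    closure_evalDualBall_eBasis_subset hg1 hgB,
    fun n m hnm => evalDualBall_injective.ne (eBasis_ne hgne hnm)⟩
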